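/- Let $n\ge 1$, let $\hat{\mathbf Z}=(\hat z_{ij})\in\mathbb C^{n\times n}$ (the normalized impedance matrix) and $\mathbf S\in\mathbb C^n$ (the load powers), and write $^*$ for the entrywise complex conjugate. Consider the power flow equation $$\mathbf v = F(\mathbf v) := \mathbf 1-\hat{\mathbf Z}\,\mathrm{diag}^{-1}(\mathbf v^*)\,\mathbf S^*,$$ for $\mathbf v\in\mathbb C^n$ without zero entries. Define, for $i=1,\dots,n$, $$\eta_i=\sum_{j}\hat z_{ij}S_j^*\in\mathbb C,\qquad \xi_i=\sum_j|\hat z_{ij}S_j^*|,\qquad \gamma_i=2(\xi_i+\mathrm{Re}\,\eta_i)-\xi_i^2-|\eta_i|^2,$$ and $\eta=\max_i|\eta_i|$, $\xi=\max_i\xi_i$, $\gamma=\max_i\gamma_i$. Suppose that $\xi>0$ and $$\gamma+2\xi\eta<1,\qquad \xi-\eta\le 1,$$ and put $$\bar r=\sqrt{\frac{1-\gamma+\sqrt{(1-\gamma)^2-4\xi^2\eta^2}}{2\xi^2}},\qquad \underline r=\sqrt{\frac{1-\gamma-\sqrt{(1-\gamma)^2-4\xi^2\eta^2}}{2\xi^2}}.$$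 For $r\ge 0$ let $D(r)=\{\mathbf v\in\mathbb C^n: |v_i-(1-\eta_i)|\le r\,\xi_i\text{ for all }i\}$, and let $\mathcal U=\{\mathbf v\in\mathbb C^n: v_i\neq 0\text{ and }|(v_i-1)/v_i|<\bar r\text{ for all }i\}$. Then: 1. The power flow equation has a unique solution $\hat{\mathbf v}$ in the closed polydisc $D(\underline r)$. 2. It has no solution in $\mathcal U\setminus D(\underline r)$. 3. For every $\mathbf v^0\in\mathcal U$ the fixed-point iteration $\mathbf v^{k+1}=F(\mathbf v^k)$ is well defined (no iterate has a zero entry) and converges to $\hat{\mathbf v}$, and there is a number $0\le\mu<1$ (which may depend on $\mathbf v^0$) such that $$\|\mathbf v^k-\hat{\mathbf v}\|_\infty<\bar r\,\xi\,(1+\mu)\left(\frac{2\mu}{1+\mu^2}\right)^{k/2}$$ for all $k\ge 1$, and also for $k=0$ if $\mathbf v^0\in D(\bar r)$. -/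

import Mathlib

namespace PowerFlow

open scoped ComplexConjugate

noncomputable section

/-- The normalized power flow map `v ↦ 1 - Ẑ diag⁻¹(v*) S*`, coordinate by coordinate.
It is meaningful at vectors `v` without zero entries. -/
def powerFlowMap {ι : Type*} [Fintype ι] (Z : Matrix ι ι ℂ) (S : ι → ℂ) (v : ι → ℂ) : ι → ℂ :=
  fun i => 1 - ∑ j, Z i j * (conj (v j))⁻¹ * conj (S j)

/-- `v` solves the power flow equation `v = 1 - Ẑ diag⁻¹(v*) S*`; in particular `diag(v*)` is
invertible, that is, no entry of `v` vanishes. -/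
def IsSolution {ι : Type*} [Fintype ι] (Z : Matrix ι ι ℂ) (S : ι → ℂ) (v : ι → ℂ) : Prop :=
  (∀ i, v i ≠ 0) ∧ v = powerFlowMap Z S v

/-- The complex stress measure `η_i`, the `i`-th entry of `Ẑ S*`. -/
def nodalEta {ι : Type*} [Fintype ι] (Z : Matrix ι ι ℂ) (S : ι → ℂ) (i : ι) : ℂ :=
  ∑ j, Z i j * conj (S j)

/-- The stress measure `ξ_i`, the `ℓ₁` norm of the `i`-th row of `Ẑ diag(S*)`. -/
def nodalXi {ι : Type*} [Fintype ι] (Z : Matrix ι ι ℂ) (S : ι → ℂ) (i : ι) : ℝ :=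
  ∑ j, ‖Z i j * conj (S j)‖

/-- The stress measure `γ_i = 2 (ξ_i + Re η_i) - ξ_i² - |η_i|²`. -/
def nodalGamma {ι : Type*} [Fintype ι] (Z : Matrix ι ι ℂ) (S : ι → ℂ) (i : ι) : ℝ :=
  2 * (nodalXi Z S i + (nodalEta Z S i).re) - nodalXi Z S i ^ 2 - ‖nodalEta Z S i‖ ^ 2

/-- `η = max_i |η_i|`. -/
def eta {ι : Type*} [Fintype ι] [Nonempty ι] (Z : Matrix ι ι ℂ) (S : ι → ℂ) : ℝ :=
  Finset.univ.sup' Finset.univ_nonempty fun i => ‖nodalEta Z S i‖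

/-- `ξ = max_i ξ_i`. -/
def xi {ι : Type*} [Fintype ι] [Nonempty ι] (Z : Matrix ι ι ℂ) (S : ι → ℂ) : ℝ :=
  Finset.univ.sup' Finset.univ_nonempty fun i => nodalXi Z S i

/-- `γ = max_i γ_i`. -/
def gamma {ι : Type*} [Fintype ι] [Nonempty ι] (Z : Matrix ι ι ℂ) (S : ι → ℂ) : ℝ :=
  Finset.univ.sup' Finset.univ_nonempty fun i => nodalGamma Z S i

/-- The larger radius `r̄`. -/
def rUpper {ι : Type*} [Fintype ι] [Nonempty ι] (Z : Matrix ι ι ℂ) (S : ι → ℂ) : ℝ :=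
  √((1 - gamma Z S + √((1 - gamma Z S) ^ 2 - 4 * xi Z S ^ 2 * eta Z S ^ 2)) / (2 * xi Z S ^ 2))

/-- The smaller radius `r̲`. -/
def rLower {ι : Type*} [Fintype ι] [Nonempty ι] (Z : Matrix ι ι ℂ) (S : ι → ℂ) : ℝ :=
  √((1 - gamma Z S - √((1 - gamma Z S) ^ 2 - 4 * xi Z S ^ 2 * eta Z S ^ 2)) / (2 * xi Z S ^ 2))

/-- The closed polydisc `{v : |v_i - (1 - η_i)| ≤ r ξ_i for all i}`. -/
def polydisc {ι : Type*} [Fintype ι] (Z : Matrix ι ι ℂ) (S : ι → ℂ) (r : ℝ) : Set (ι → ℂ) :=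
  {v | ∀ i, ‖v i - (1 - nodalEta Z S i)‖ ≤ r * nodalXi Z S i}

/-- The region `{v : |(v_i - 1) / v_i| < r for all i}`, whose elements have no zero entries. -/
def region {ι : Type*} (r : ℝ) : Set (ι → ℂ) :=
  {v | ∀ i, v i ≠ 0 ∧ ‖(v i - 1) / v i‖ < r}

end

end PowerFlow

namespace PowerFlow

open scoped ComplexConjugate
open Filter Topology

/-! In the coordinate u_j = (v_j - 1)/v_j the map is affine in conj u: F(v)_i = (1 - η_i) + ∑ c_ij
conj(u_j), with c_ij = Z_ij conj(S_j). Hence |u_j| ≤ r for all j puts F(v) in D(r). For r̲ < r < r̄,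
D(r) lies in turn in {|u_j| < r}: r̲² and r̄² are the roots of ξ²x² - (1 - γ)x + η², which for x ≥ 0
dominates the analogous quadratic of every node.

Contraction is measured by |u_j - u'_j|² / ((r² - |u_j|²)(r² - |u'_j|²)), up to a constant sinh² of
half the hyperbolic distance in the disc. Cauchy–Schwarz carries a bound K on it through the sums
(`norm_sum_mul_sub_sq_le`), and a margin t > 1 (`norm_sq_lt_of_quadratic`) turns K into K/t²
(`IsContractionRadius.contraction`). Orbits therefore merge geometrically, which gives existence,
uniqueness and convergence; any two points of U share some r < r̄. -/

lemma norm_sq_lt_of_quadratic {e A : ℂ} {x r t P : ℝ} (hx : 0 ≤ x) (hr : x * (1 - r ^ 2) ≤ 1)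
    (ht : 1 < t)
    (hdisc : 0 < t * (r ^ 2 * ‖1 - e‖ ^ 2 - ‖e‖ ^ 2) - x * r ^ 2 * (1 + t ^ 2)
      - t * x ^ 2 * r ^ 2 * (r ^ 2 - 1))
    (hP : P ≤ r ^ 2 * x) (hA : ‖A‖ ^ 2 ≤ x * (r ^ 2 * x - P)) :
    t * P < r ^ 2 * ‖1 - e + A‖ ^ 2 - ‖1 - e + A - 1‖ ^ 2 := by
  simp only [Complex.sq_norm, Complex.normSq_apply, Complex.add_re, Complex.add_im, Complex.sub_re,
    Complex.sub_im, Complex.one_re, Complex.one_im] at *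
  obtain ⟨p, q⟩ := e
  obtain ⟨a, b⟩ := A
  dsimp only at *
  rcases hx.eq_or_lt with rfl | hx
  · have ha : a = 0 := by nlinarith
    have hb : b = 0 := by nlinarith
    subst ha hb
    have h1 : 0 < r ^ 2 * ((1 - p) * (1 - p) + (0 - q) * (0 - q)) - (p * p + q * q) := by
      by_contra! h
      nlinarith
    nlinarith
  · have hα : 0 < x * (r ^ 2 - 1) + t := by linarith
    -- The second factor is a quadratic in A with leading coefficient α = x(r² - 1) + t. Completing
    -- the square, the product is |αA + x((r² - 1)(1 - e) + 1)|² plus x times the quantity in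
    -- `hdisc`.
    have key : 0 < (x * (r ^ 2 - 1) + t) * (x * (r ^ 2 * ((1 - p + a) * (1 - p + a)
        + (0 - q + b) * (0 - q + b)) - ((1 - p + a - 1) * (1 - p + a - 1)
        + (0 - q + b - 0) * (0 - q + b - 0))) + t * (a * a + b * b) - t * r ^ 2 * x ^ 2) := by
      have hxd := mul_pos hx hdisc
      have h1 := sq_nonneg ((x * (r ^ 2 - 1) + t) * a + x * ((r ^ 2 - 1) * (1 - p) + 1))
      have h2 := sq_nonneg ((x * (r ^ 2 - 1) + t) * b + x * ((r ^ 2 - 1) * (-q)))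
      nlinarith
    have h3 := pos_of_mul_pos_right key hα.le
    have h4 : t * (a * a + b * b) ≤ t * (x * (r ^ 2 * x - P)) :=
      mul_le_mul_of_nonneg_left hA (by linarith)
    refine lt_of_mul_lt_mul_left ?_ hx.le
    nlinarith

/-! ### Weighted Cauchy–Schwarz estimates -/

section Sums

variable {ι : Type*} [Fintype ι] {c a b : ι → ℂ} {r K : ℝ}

lemma norm_sum_mul_sq_le (c a : ι → ℂ) :
    ‖∑ j, c j * a j‖ ^ 2 ≤ (∑ j, ‖c j‖) * ∑ j, ‖c j‖ * ‖a j‖ ^ 2 := by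
  refine (pow_le_pow_left₀ (norm_nonneg _) (norm_sum_le _ _) 2).trans ?_
  refine Finset.sum_sq_le_sum_mul_sum_of_sq_le_mul _ (fun j _ => norm_nonneg _)
    (fun j _ => by positivity) fun j _ => le_of_eq ?_
  rw [norm_mul]
  ring

lemma norm_sum_mul_sub_sq_le (ha : ∀ j, ‖a j‖ ^ 2 ≤ r ^ 2) (hb : ∀ j, ‖b j‖ ^ 2 ≤ r ^ 2)
    (hK : 0 ≤ K)
    (h : ∀ j, ‖a j - b j‖ ^ 2 ≤ K * (r ^ 2 - ‖a j‖ ^ 2) * (r ^ 2 - ‖b j‖ ^ 2)) :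
    ‖∑ j, c j * a j - ∑ j, c j * b j‖ ^ 2 ≤
      K * (∑ j, ‖c j‖ * (r ^ 2 - ‖a j‖ ^ 2)) * ∑ j, ‖c j‖ * (r ^ 2 - ‖b j‖ ^ 2) := by
  have h0 : ‖∑ j, c j * a j - ∑ j, c j * b j‖ ≤
      ∑ j, √(K * (‖c j‖ * (r ^ 2 - ‖a j‖ ^ 2))) * √(‖c j‖ * (r ^ 2 - ‖b j‖ ^ 2)) := by
    rw [← Finset.sum_sub_distrib]
    refine (norm_sum_le _ _).trans (Finset.sum_le_sum fun j _ => ?_)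
    have := sub_nonneg.2 (ha j)
    have := sub_nonneg.2 (hb j)
    rw [← mul_sub, norm_mul, ← Real.sqrt_mul (by positivity)]
    refine Real.le_sqrt_of_sq_le ?_
    calc (‖c j‖ * ‖a j - b j‖) ^ 2 = ‖c j‖ ^ 2 * ‖a j - b j‖ ^ 2 := by ring
      _ ≤ ‖c j‖ ^ 2 * (K * (r ^ 2 - ‖a j‖ ^ 2) * (r ^ 2 - ‖b j‖ ^ 2)) := by
        gcongr
        exact h j
      _ = _ := by ring
  refine (pow_le_pow_left₀ (norm_nonneg _) h0 2).trans ?_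
  refine (Finset.sum_mul_sq_le_sq_mul_sq _ _ _).trans (le_of_eq ?_)
  rw [Finset.mul_sum _ _ K]
  congr 1 <;> refine Finset.sum_congr rfl fun j _ => Real.sq_sqrt ?_
  · have := sub_nonneg.2 (ha j)
    positivity
  · have := sub_nonneg.2 (hb j)
    positivity

end Sums

/-- As μ → 1 the prefactor tends to 2M > C and the ratio to 1. So μ near 1 lets the uniform bound C
serve up to the index N where A l^N ≤ C, and the geometric decay serve beyond it. -/
lemma exists_rate {M C A l : ℝ} (hC : 0 < C) (hCM : C < 2 * M) (hl : 0 < l) (hl1 : l < 1) :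
    ∃ μ : ℝ, 0 ≤ μ ∧ μ < 1 ∧ ∀ k : ℕ, ∀ d : ℝ, d ≤ C → d ≤ A * l ^ k →
      d < M * (1 + μ) * (2 * μ / (1 + μ ^ 2)) ^ ((k : ℝ) / 2) := by
  obtain ⟨N, hN⟩ : ∃ N : ℕ, A * l ^ N ≤ C := by
    have h : Tendsto (fun n : ℕ => A * l ^ n) atTop (𝓝 (A * 0)) :=
      (tendsto_pow_atTop_nhds_zero_of_lt_one hl.le hl1).const_mul A
    rw [mul_zero] at h
    exact (h.eventually_le_const hC).exists
  have hden : ∀ μ : ℝ, 1 + μ ^ 2 ≠ 0 := fun μ => by positivity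
  have hρ : Continuous fun μ : ℝ => √(2 * μ / (1 + μ ^ 2)) := by fun_prop (disch := exact hden _)
  have hfun : Continuous fun μ : ℝ => M * (1 + μ) * √(2 * μ / (1 + μ ^ 2)) ^ N := by fun_prop
  have e1 : ∀ᶠ μ in 𝓝 (1 : ℝ), l < √(2 * μ / (1 + μ ^ 2)) :=
    hρ.continuousAt.eventually_const_lt (by norm_num; exact hl1)
  have e2 : ∀ᶠ μ in 𝓝 (1 : ℝ), C < M * (1 + μ) * √(2 * μ / (1 + μ ^ 2)) ^ N :=
    hfun.continuousAt.eventually_const_lt (by norm_num; linarith)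
  have e3 : ∀ᶠ μ in 𝓝 (1 : ℝ), 0 < μ := lt_mem_nhds one_pos
  obtain ⟨μ, hμ1, hμ, hN', hμ0⟩ := ((((e1.and (e2.and e3)).filter_mono nhdsWithin_le_nhds).and
    (self_mem_nhdsWithin (s := Set.Iio (1 : ℝ)))).exists.imp fun _ h => ⟨h.2, h.1⟩ :
      ∃ μ : ℝ, μ < 1 ∧ _)
  have hM : 0 < M := by linarith
  refine ⟨μ, hμ0.le, hμ1, fun k d hd hd' => ?_⟩
  rw [Real.rpow_div_two_eq_sqrt _ (by positivity), Real.rpow_natCast]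
  set ρ := √(2 * μ / (1 + μ ^ 2))
  have hρ1 : ρ ≤ 1 := by
    refine Real.sqrt_le_one.2 ?_
    rw [div_le_one (by positivity)]
    nlinarith [sq_nonneg (μ - 1)]
  have hρ0 : 0 < ρ := hl.trans hμ
  have hMμ : 0 < M * (1 + μ) := by positivity
  rcases le_total k N with hk | hk
  · calc d ≤ C := hd
      _ < _ := hN'
      _ ≤ _ := mul_le_mul_of_nonneg_left (pow_le_pow_of_le_one hρ0.le hρ1 hk) hMμ.le
  · obtain ⟨m, rfl⟩ := Nat.exists_eq_add_of_le hk
    calc d ≤ A * l ^ N * l ^ m := by rw [mul_assoc, ← pow_add]; exact hd'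
      _ ≤ C * l ^ m := by gcongr
      _ ≤ C * ρ ^ m := by gcongr
      _ < (M * (1 + μ) * ρ ^ N) * ρ ^ m := by gcongr
      _ = _ := by rw [pow_add]; ring

/-! ### The radii as roots of a quadratic -/

section Radii

variable {ι : Type*} [Fintype ι] [Nonempty ι] {Z : Matrix ι ι ℂ} {S : ι → ℂ} {r : ℝ}

omit [Nonempty ι] in
lemma nodalXi_nonneg (Z : Matrix ι ι ℂ) (S : ι → ℂ) (i : ι) : 0 ≤ nodalXi Z S i :=
  Finset.sum_nonneg fun _ _ => norm_nonneg _

lemma nodalXi_le_xi (Z : Matrix ι ι ℂ) (S : ι → ℂ) (i : ι) : nodalXi Z S i ≤ xi Z S :=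
  Finset.le_sup' (fun i => nodalXi Z S i) (Finset.mem_univ i)

lemma norm_nodalEta_le_eta (Z : Matrix ι ι ℂ) (S : ι → ℂ) (i : ι) : ‖nodalEta Z S i‖ ≤ eta Z S :=
  Finset.le_sup' (fun i => ‖nodalEta Z S i‖) (Finset.mem_univ i)

lemma nodalGamma_le_gamma (Z : Matrix ι ι ℂ) (S : ι → ℂ) (i : ι) :
    nodalGamma Z S i ≤ gamma Z S :=
  Finset.le_sup' (fun i => nodalGamma Z S i) (Finset.mem_univ i)

lemma eta_nonneg (Z : Matrix ι ι ℂ) (S : ι → ℂ) : 0 ≤ eta Z S :=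
  (norm_nonneg _).trans (norm_nodalEta_le_eta Z S (Classical.arbitrary ι))

lemma discr_pos (hξ : 0 < xi Z S) (h₁ : gamma Z S + 2 * xi Z S * eta Z S < 1) :
    0 < (1 - gamma Z S) ^ 2 - 4 * xi Z S ^ 2 * eta Z S ^ 2 := by
  have := mul_nonneg hξ.le (eta_nonneg Z S)
  nlinarith

lemma rLower_nonneg : 0 ≤ rLower Z S := Real.sqrt_nonneg _

lemma sqrt_discr_le (hξ : 0 < xi Z S) (h₁ : gamma Z S + 2 * xi Z S * eta Z S < 1) :
    √((1 - gamma Z S) ^ 2 - 4 * xi Z S ^ 2 * eta Z S ^ 2) ≤ 1 - gamma Z S := by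
  have := mul_nonneg hξ.le (eta_nonneg Z S)
  refine Real.sqrt_le_iff.2 ⟨by linarith, ?_⟩
  have : 0 ≤ 4 * xi Z S ^ 2 * eta Z S ^ 2 := by positivity
  linarith

lemma rLower_sq (hξ : 0 < xi Z S) (h₁ : gamma Z S + 2 * xi Z S * eta Z S < 1) :
    rLower Z S ^ 2 = (1 - gamma Z S - √((1 - gamma Z S) ^ 2 - 4 * xi Z S ^ 2 * eta Z S ^ 2)) /
      (2 * xi Z S ^ 2) :=
  Real.sq_sqrt (div_nonneg (sub_nonneg.2 (sqrt_discr_le hξ h₁)) (by positivity))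

lemma rUpper_sq (hξ : 0 < xi Z S) (h₁ : gamma Z S + 2 * xi Z S * eta Z S < 1) :
    rUpper Z S ^ 2 = (1 - gamma Z S + √((1 - gamma Z S) ^ 2 - 4 * xi Z S ^ 2 * eta Z S ^ 2)) /
      (2 * xi Z S ^ 2) := by
  have h := sqrt_discr_le hξ h₁
  have h0 := Real.sqrt_nonneg ((1 - gamma Z S) ^ 2 - 4 * xi Z S ^ 2 * eta Z S ^ 2)
  exact Real.sq_sqrt (div_nonneg (by linarith) (by positivity))

lemma rLower_lt_rUpper (hξ : 0 < xi Z S) (h₁ : gamma Z S + 2 * xi Z S * eta Z S < 1) :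
    rLower Z S < rUpper Z S := by
  have h0 := Real.sqrt_pos.2 (discr_pos hξ h₁)
  refine lt_of_pow_lt_pow_left₀ 2 (Real.sqrt_nonneg _) ?_
  rw [rLower_sq hξ h₁, rUpper_sq hξ h₁]
  gcongr
  linarith

lemma quadratic_factor (hξ : 0 < xi Z S) (h₁ : gamma Z S + 2 * xi Z S * eta Z S < 1) (x : ℝ) :
    xi Z S ^ 2 * x ^ 2 - (1 - gamma Z S) * x + eta Z S ^ 2 =
      xi Z S ^ 2 * ((x - rLower Z S ^ 2) * (x - rUpper Z S ^ 2)) := by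
  rw [rLower_sq hξ h₁, rUpper_sq hξ h₁]
  have h := Real.sq_sqrt (discr_pos hξ h₁).le
  set s := √((1 - gamma Z S) ^ 2 - 4 * xi Z S ^ 2 * eta Z S ^ 2)
  field_simp
  linear_combination h

lemma nodal_quadratic_neg (hξ : 0 < xi Z S) (h₁ : gamma Z S + 2 * xi Z S * eta Z S < 1) {x : ℝ}
    (hx : rLower Z S ^ 2 < x) (hx' : x < rUpper Z S ^ 2) (i : ι) :
    nodalXi Z S i ^ 2 * x ^ 2 - (1 - nodalGamma Z S i) * x + ‖nodalEta Z S i‖ ^ 2 < 0 := by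
  have h0 : 0 < x := (sq_nonneg _).trans_lt hx
  have h := quadratic_factor hξ h₁ x
  have hneg : xi Z S ^ 2 * ((x - rLower Z S ^ 2) * (x - rUpper Z S ^ 2)) < 0 :=
    mul_neg_of_pos_of_neg (by positivity) (mul_neg_of_pos_of_neg (by linarith) (by linarith))
  have a1 : nodalXi Z S i ^ 2 * x ^ 2 ≤ xi Z S ^ 2 * x ^ 2 := by
    have := nodalXi_nonneg Z S i
    have := nodalXi_le_xi Z S i
    gcongr
  have a2 : nodalGamma Z S i * x ≤ gamma Z S * x := by
    have := nodalGamma_le_gamma Z S i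
    gcongr
  have a3 : ‖nodalEta Z S i‖ ^ 2 ≤ eta Z S ^ 2 := by
    have := norm_nodalEta_le_eta Z S i
    gcongr
  linarith

/-- Keeps the leading coefficient α in `norm_sq_lt_of_quadratic` positive; this is where ξ - η ≤ 1
enters. -/
lemma nodalXi_mul_one_sub_sq_le (hξ : 0 < xi Z S) (h₁ : gamma Z S + 2 * xi Z S * eta Z S < 1)
    (h₂ : xi Z S - eta Z S ≤ 1) (hr : rLower Z S < r) (i : ι) :
    nodalXi Z S i * (1 - r ^ 2) ≤ 1 := by
  by_contra! h
  have hη := eta_nonneg Z S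
  have hl := nodalXi_le_xi Z S i
  have hr2 : rLower Z S ^ 2 < r ^ 2 := by
    have := rLower_nonneg (Z := Z) (S := S)
    gcongr
  have hi : 0 < nodalXi Z S i := by
    rcases (nodalXi_nonneg Z S i).eq_or_lt with h' | h'
    · rw [← h'] at h
      linarith
    · exact h'
  obtain ⟨x, hx⟩ : ∃ x, x = 1 - 1 / nodalXi Z S i := ⟨_, rfl⟩
  have hix : nodalXi Z S i * (1 - x) = 1 := by
    rw [hx]
    field_simp
    ring
  have hrx : r ^ 2 < x := by
    have : nodalXi Z S i * x > nodalXi Z S i * r ^ 2 := by linarith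
    exact lt_of_mul_lt_mul_left this hi.le
  have hx1 : x < 1 := by
    by_contra! hx1
    nlinarith
  have hxm : xi Z S * x ≤ eta Z S := by nlinarith
  have hη0 : 0 < eta Z S := by
    have : 0 < x := (sq_nonneg _).trans_lt hrx
    have := mul_pos hξ this
    linarith
  -- η/ξ is the geometric mean of the two roots, and the quadratic is negative there.
  have hm : eta Z S / xi Z S < rUpper Z S ^ 2 := by
    have hq := quadratic_factor hξ h₁ (eta Z S / xi Z S)
    have he : xi Z S ^ 2 * (eta Z S / xi Z S) ^ 2 - (1 - gamma Z S) * (eta Z S / xi Z S)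
        + eta Z S ^ 2 = (eta Z S / xi Z S) * (gamma Z S + 2 * xi Z S * eta Z S - 1) := by
      field_simp
      ring
    have hneg : (eta Z S / xi Z S) * (gamma Z S + 2 * xi Z S * eta Z S - 1) < 0 :=
      mul_neg_of_pos_of_neg (by positivity) (by linarith)
    have hxm' : x ≤ eta Z S / xi Z S := by
      rw [le_div_iff₀ hξ]
      linarith
    by_contra! hm
    have : 0 ≤ xi Z S ^ 2 * ((eta Z S / xi Z S - rLower Z S ^ 2) *
        (eta Z S / xi Z S - rUpper Z S ^ 2)) :=
      mul_nonneg (by positivity) (mul_nonneg (by linarith) (by linarith))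
    linarith
  have hxU : x < rUpper Z S ^ 2 := by
    refine lt_of_le_of_lt ?_ hm
    rw [le_div_iff₀ hξ]
    linarith
  have hneg := nodal_quadratic_neg hξ h₁ (hr2.trans hrx) hxU i
  -- With y = ξ_i, (1 - x) times the nodal quadratic equals |η_i(1 - x) + x|² - x(1 - y(1 - x))².
  -- The choice of x kills the last term, so the quadratic cannot be negative.
  have hpos : 0 ≤ ‖nodalEta Z S i * ((1 - x : ℝ) : ℂ) + (x : ℂ)‖ ^ 2 := by positivity
  simp only [nodalGamma, Complex.sq_norm, Complex.normSq_apply, Complex.add_re, Complex.add_im,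
    Complex.mul_re, Complex.mul_im, Complex.ofReal_re, Complex.ofReal_im] at hneg hpos
  have hmul := mul_neg_of_pos_of_neg (sub_pos.2 hx1) hneg
  set y := nodalXi Z S i
  have hsq : x * (1 - y * (1 - x)) ^ 2 = 0 := by rw [hix]; ring
  nlinarith

/-- `r` is a radius at which the power flow map contracts, with expansion factor `t` of the
defining function of the disc `|v - 1| < r |v|` against that of the nodal disc. -/
def IsContractionRadius (Z : Matrix ι ι ℂ) (S : ι → ℂ) (r t : ℝ) : Prop :=
  0 < r ∧ 1 < t ∧ ∀ (i : ι) (v : ℂ) (P : ℝ), P ≤ r ^ 2 * nodalXi Z S i →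
    ‖v - (1 - nodalEta Z S i)‖ ^ 2 ≤ nodalXi Z S i * (r ^ 2 * nodalXi Z S i - P) →
    t * P < r ^ 2 * ‖v‖ ^ 2 - ‖v - 1‖ ^ 2

lemma exists_isContractionRadius (hξ : 0 < xi Z S)
    (h₁ : gamma Z S + 2 * xi Z S * eta Z S < 1) (h₂ : xi Z S - eta Z S ≤ 1)
    (hr : rLower Z S < r) (hr' : r < rUpper Z S) : ∃ t, IsContractionRadius Z S r t := by
  have h0 := rLower_nonneg (Z := Z) (S := S)
  have hr0 : 0 < r := h0.trans_lt hr
  have ev : ∀ᶠ t in 𝓝 (1 : ℝ), ∀ i,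
      0 < t * (r ^ 2 * ‖1 - nodalEta Z S i‖ ^ 2 - ‖nodalEta Z S i‖ ^ 2)
        - nodalXi Z S i * r ^ 2 * (1 + t ^ 2)
        - t * nodalXi Z S i ^ 2 * r ^ 2 * (r ^ 2 - 1) := by
    refine eventually_all.2 fun i => ?_
    refine Tendsto.eventually_const_lt ?_ (Continuous.tendsto (by fun_prop) 1)
    -- At t = 1 the expression is minus the nodal quadratic at r², so strictness leaves room for
    -- some t > 1.
    have h := nodal_quadratic_neg hξ h₁ (x := r ^ 2) (by gcongr) (by gcongr) i
    simp only [nodalGamma, Complex.sq_norm, Complex.normSq_apply, Complex.sub_re, Complex.sub_im,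
      Complex.one_re, Complex.one_im] at h ⊢
    nlinarith
  obtain ⟨t, ht, ht1⟩ := ((ev.filter_mono nhdsWithin_le_nhds).and
    (self_mem_nhdsWithin (s := Set.Ioi (1 : ℝ)))).exists
  refine ⟨t, hr0, ht1, fun i v P hP hv => ?_⟩
  have := norm_sq_lt_of_quadratic (nodalXi_nonneg Z S i)
    (nodalXi_mul_one_sub_sq_le hξ h₁ h₂ hr i) ht1 (ht i) hP hv
  simpa using this

/-! ### The map in the coordinate (v - 1)/v -/

omit [Nonempty ι] in
lemma powerFlowMap_apply_sub {v : ι → ℂ} (hv : ∀ j, v j ≠ 0) (i : ι) :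
    powerFlowMap Z S v i - (1 - nodalEta Z S i) =
      ∑ j, Z i j * conj (S j) * conj ((v j - 1) / v j) := by
  have : ∀ j, Z i j * conj (S j) * conj ((v j - 1) / v j) =
      Z i j * conj (S j) - Z i j * (conj (v j))⁻¹ * conj (S j) := fun j => by
    have : conj (v j) ≠ 0 := by simpa using hv j
    simp only [map_div₀, map_sub, map_one]
    field_simp
  simp only [this, Finset.sum_sub_distrib, powerFlowMap, nodalEta]
  ring

omit [Nonempty ι] in
lemma polydisc_mono {r s : ℝ} (h : r ≤ s) : polydisc Z S r ⊆ polydisc Z S s := fun _ hv i =>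
  (hv i).trans (mul_le_mul_of_nonneg_right h (nodalXi_nonneg Z S i))

omit [Nonempty ι] in
lemma isClosed_polydisc : IsClosed (polydisc Z S r) := by
  simp only [polydisc, Set.ofPred_forall]
  exact isClosed_iInter fun i => isClosed_le (by fun_prop) continuous_const

omit [Fintype ι] [Nonempty ι] in
lemma region_mono {r s : ℝ} (h : r ≤ s) : region (ι := ι) r ⊆ region s := fun _ hv i =>
  ⟨(hv i).1, (hv i).2.trans_le h⟩

lemma norm_sub_le_of_mem_polydisc {s : ℝ} (hr : 0 ≤ r + s) {v w : ι → ℂ}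
    (hv : v ∈ polydisc Z S r) (hw : w ∈ polydisc Z S s) : ‖v - w‖ ≤ (r + s) * xi Z S := by
  refine (pi_norm_le_iff_of_nonneg (mul_nonneg hr ((nodalXi_nonneg Z S
    (Classical.arbitrary ι)).trans (nodalXi_le_xi Z S _)))).2 fun i => ?_
  calc ‖(v - w) i‖ = ‖(v i - (1 - nodalEta Z S i)) - (w i - (1 - nodalEta Z S i))‖ := by
        rw [Pi.sub_apply]
        congr 1
        ring
    _ ≤ r * nodalXi Z S i + s * nodalXi Z S i := (norm_sub_le _ _).trans (add_le_add (hv i) (hw i))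
    _ = (r + s) * nodalXi Z S i := by ring
    _ ≤ _ := mul_le_mul_of_nonneg_left (nodalXi_le_xi Z S i) hr

omit [Nonempty ι] in
lemma powerFlowMap_mem_polydisc {v : ι → ℂ} (hv : ∀ j, v j ≠ 0)
    (h : ∀ j, ‖(v j - 1) / v j‖ ≤ r) : powerFlowMap Z S v ∈ polydisc Z S r := fun i => by
  rw [powerFlowMap_apply_sub hv, nodalXi, Finset.mul_sum]
  refine (norm_sum_le _ _).trans (Finset.sum_le_sum fun j _ => ?_)
  rw [norm_mul, Complex.norm_conj, mul_comm]
  exact mul_le_mul_of_nonneg_right (h j) (norm_nonneg _)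

/-! ### Invariance and contraction at a fixed radius -/

namespace IsContractionRadius

variable {t : ℝ} (h : IsContractionRadius Z S r t)

include h

omit [Nonempty ι] in
lemma polydisc_subset_region : polydisc Z S r ⊆ region r := fun v hv i => by
  obtain ⟨hr, ht, h⟩ := h
  have hx := nodalXi_nonneg Z S i
  have h1 := h i (v i) 0 (by positivity) (by
    calc _ ≤ (r * nodalXi Z S i) ^ 2 := pow_le_pow_left₀ (norm_nonneg _) (hv i) 2
      _ = _ := by ring)
  have h0 : v i ≠ 0 := fun h0 => by
    rw [h0] at h1
    norm_num at h1
  refine ⟨h0, ?_⟩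
  rw [norm_div, div_lt_iff₀ (norm_pos_iff.2 h0)]
  refine lt_of_pow_lt_pow_left₀ 2 (by positivity) ?_
  rw [mul_pow]
  linarith

omit [Nonempty ι] in
lemma powerFlowMap_mem_region {v : ι → ℂ} (hv : v ∈ region r) :
    powerFlowMap Z S v ∈ region r :=
  h.polydisc_subset_region (powerFlowMap_mem_polydisc (fun j => (hv j).1) fun j => (hv j).2.le)

omit [Nonempty ι] in
lemma iterate_mem_region {v : ι → ℂ} (hv : v ∈ region r) (k : ℕ) :
    (powerFlowMap Z S)^[k] v ∈ region r := by
  induction k with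
  | zero => exact hv
  | succ k ih =>
    rw [Function.iterate_succ_apply']
    exact h.powerFlowMap_mem_region ih

omit [Nonempty ι] in
lemma weight_lt {v : ι → ℂ} (hv : v ∈ region r) (i : ι) :
    t * ∑ j, ‖Z i j * conj (S j)‖ * (r ^ 2 - ‖(v j - 1) / v j‖ ^ 2) <
      ‖powerFlowMap Z S v i‖ ^ 2 *
        (r ^ 2 - ‖(powerFlowMap Z S v i - 1) / powerFlowMap Z S v i‖ ^ 2) := by
  have h0 : 0 < ‖powerFlowMap Z S v i‖ := norm_pos_iff.2 (h.powerFlowMap_mem_region hv i).1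
  have hs : ∑ j, ‖Z i j * conj (S j)‖ * (r ^ 2 - ‖(v j - 1) / v j‖ ^ 2) =
      r ^ 2 * nodalXi Z S i - ∑ j, ‖Z i j * conj (S j)‖ * ‖(v j - 1) / v j‖ ^ 2 := by
    rw [nodalXi, Finset.mul_sum, ← Finset.sum_sub_distrib]
    exact Finset.sum_congr rfl fun j _ => by ring
  have key := h.2.2 i (powerFlowMap Z S v i)
    (∑ j, ‖Z i j * conj (S j)‖ * (r ^ 2 - ‖(v j - 1) / v j‖ ^ 2)) (by
      rw [hs]
      exact sub_le_self _ (Finset.sum_nonneg fun j _ => by positivity)) (by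
      rw [powerFlowMap_apply_sub fun j => (hv j).1, hs, sub_sub_cancel]
      simpa only [Complex.norm_conj, nodalXi] using norm_sum_mul_sq_le
        (fun j => Z i j * conj (S j)) (fun j => conj ((v j - 1) / v j)))
  refine key.trans_eq ?_
  rw [norm_div]
  field_simp

omit [Nonempty ι] h in
lemma norm_powerFlowMap_sub_sq_le {v w : ι → ℂ} (hv : v ∈ region r) (hw : w ∈ region r) {K : ℝ}
    (hK : 0 ≤ K)
    (hvw : ∀ j, ‖(v j - 1) / v j - (w j - 1) / w j‖ ^ 2 ≤
      K * (r ^ 2 - ‖(v j - 1) / v j‖ ^ 2) * (r ^ 2 - ‖(w j - 1) / w j‖ ^ 2)) (i : ι) :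
    ‖powerFlowMap Z S v i - powerFlowMap Z S w i‖ ^ 2 ≤
      K * (∑ j, ‖Z i j * conj (S j)‖ * (r ^ 2 - ‖(v j - 1) / v j‖ ^ 2)) *
        ∑ j, ‖Z i j * conj (S j)‖ * (r ^ 2 - ‖(w j - 1) / w j‖ ^ 2) := by
  have e : powerFlowMap Z S v i - powerFlowMap Z S w i =
      ∑ j, Z i j * conj (S j) * conj ((v j - 1) / v j) -
        ∑ j, Z i j * conj (S j) * conj ((w j - 1) / w j) := by
    rw [← powerFlowMap_apply_sub fun j => (hv j).1, ← powerFlowMap_apply_sub fun j => (hw j).1]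
    ring
  rw [e]
  have := norm_sum_mul_sub_sq_le (c := fun j => Z i j * conj (S j))
    (a := fun j => conj ((v j - 1) / v j)) (b := fun j => conj ((w j - 1) / w j)) (r := r)
    (fun j => by
      rw [Complex.norm_conj]
      exact pow_le_pow_left₀ (norm_nonneg _) (hv j).2.le 2)
    (fun j => by
      rw [Complex.norm_conj]
      exact pow_le_pow_left₀ (norm_nonneg _) (hw j).2.le 2) hK
    (fun j => by
      rw [← map_sub]
      simpa only [Complex.norm_conj] using hvw j)
  simpa only [Complex.norm_conj] using this

omit [Nonempty ι] h in
lemma sum_weight_nonneg {v : ι → ℂ} (hv : v ∈ region r) (i : ι) :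
    0 ≤ ∑ j, ‖Z i j * conj (S j)‖ * (r ^ 2 - ‖(v j - 1) / v j‖ ^ 2) :=
  Finset.sum_nonneg fun j _ => mul_nonneg (norm_nonneg _)
    (sub_nonneg.2 (pow_le_pow_left₀ (norm_nonneg _) (hv j).2.le 2))

omit h in
lemma sum_weight_le (v : ι → ℂ) (i : ι) :
    ∑ j, ‖Z i j * conj (S j)‖ * (r ^ 2 - ‖(v j - 1) / v j‖ ^ 2) ≤ r ^ 2 * xi Z S := by
  refine le_trans ?_ (mul_le_mul_of_nonneg_left (nodalXi_le_xi Z S i) (sq_nonneg r))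
  rw [nodalXi, Finset.mul_sum]
  refine Finset.sum_le_sum fun j _ => ?_
  rw [mul_comm]
  exact mul_le_mul_of_nonneg_right (sub_le_self _ (by positivity)) (norm_nonneg _)

omit [Nonempty ι] in
lemma contraction {v w : ι → ℂ} (hv : v ∈ region r) (hw : w ∈ region r) {K : ℝ}
    (hK : 0 ≤ K)
    (hvw : ∀ j, ‖(v j - 1) / v j - (w j - 1) / w j‖ ^ 2 ≤
      K * (r ^ 2 - ‖(v j - 1) / v j‖ ^ 2) * (r ^ 2 - ‖(w j - 1) / w j‖ ^ 2)) (i : ι) :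
    ‖(powerFlowMap Z S v i - 1) / powerFlowMap Z S v i -
        (powerFlowMap Z S w i - 1) / powerFlowMap Z S w i‖ ^ 2 ≤
      K * t⁻¹ ^ 2 * (r ^ 2 - ‖(powerFlowMap Z S v i - 1) / powerFlowMap Z S v i‖ ^ 2) *
        (r ^ 2 - ‖(powerFlowMap Z S w i - 1) / powerFlowMap Z S w i‖ ^ 2) := by
  have ht : 0 < t := one_pos.trans h.2.1
  have hv0 := (h.powerFlowMap_mem_region hv i).1
  have hw0 := (h.powerFlowMap_mem_region hw i).1
  have l1 := (h.weight_lt hv i).le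
  have l2 := (h.weight_lt hw i).le
  have n1 := sum_weight_nonneg (Z := Z) (S := S) hv i
  have n2 := sum_weight_nonneg (Z := Z) (S := S) hw i
  have m := norm_powerFlowMap_sub_sq_le (Z := Z) (S := S) hv hw hK hvw i
  set p := powerFlowMap Z S v i
  set q := powerFlowMap Z S w i
  set P := ∑ j, ‖Z i j * conj (S j)‖ * (r ^ 2 - ‖(v j - 1) / v j‖ ^ 2)
  set Q := ∑ j, ‖Z i j * conj (S j)‖ * (r ^ 2 - ‖(w j - 1) / w j‖ ^ 2)
  have e : (p - 1) / p - (q - 1) / q = (p - q) / (p * q) := by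
    field_simp
    ring
  rw [e, norm_div, norm_mul, div_pow, mul_pow, div_le_iff₀ (by positivity)]
  refine m.trans ?_
  have l3 := mul_le_mul l1 l2 (by positivity) ((mul_nonneg ht.le n1).trans l1)
  calc K * P * Q = K * t⁻¹ ^ 2 * (t * P * (t * Q)) := by field_simp
    _ ≤ K * t⁻¹ ^ 2 * _ := mul_le_mul_of_nonneg_left l3 (by positivity)
    _ = _ := by ring

lemma exists_geometric_bound {v w : ι → ℂ} (hv : v ∈ region r) (hw : w ∈ region r) :
    ∃ A : ℝ, ∀ k : ℕ,
      ‖(powerFlowMap Z S)^[k] v - (powerFlowMap Z S)^[k] w‖ ≤ A * t⁻¹ ^ k := by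
  have ht : 0 < t := one_pos.trans h.2.1
  have pos : ∀ {u : ι → ℂ}, u ∈ region r → ∀ j, 0 < r ^ 2 - ‖(u j - 1) / u j‖ ^ 2 :=
    fun hu j => sub_pos.2 (pow_lt_pow_left₀ (hu j).2 (norm_nonneg _) two_ne_zero)
  obtain ⟨K, hK, hK'⟩ : ∃ K : ℝ, 0 ≤ K ∧ ∀ j, ‖(v j - 1) / v j - (w j - 1) / w j‖ ^ 2 ≤
      K * (r ^ 2 - ‖(v j - 1) / v j‖ ^ 2) * (r ^ 2 - ‖(w j - 1) / w j‖ ^ 2) := by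
    have nn : ∀ j, 0 ≤ ‖(v j - 1) / v j - (w j - 1) / w j‖ ^ 2 /
        ((r ^ 2 - ‖(v j - 1) / v j‖ ^ 2) * (r ^ 2 - ‖(w j - 1) / w j‖ ^ 2)) := fun j =>
      div_nonneg (sq_nonneg _) (mul_pos (pos hv j) (pos hw j)).le
    refine ⟨_, Finset.sum_nonneg (s := Finset.univ) fun j _ => nn j, fun j => ?_⟩
    rw [mul_assoc, ← div_le_iff₀ (mul_pos (pos hv j) (pos hw j))]
    exact Finset.single_le_sum (f := fun j => ‖(v j - 1) / v j - (w j - 1) / w j‖ ^ 2 /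
      ((r ^ 2 - ‖(v j - 1) / v j‖ ^ 2) * (r ^ 2 - ‖(w j - 1) / w j‖ ^ 2)))
      (fun j _ => nn j) (Finset.mem_univ j)
  have hk : ∀ k : ℕ, ∀ j, ‖((powerFlowMap Z S)^[k] v j - 1) / (powerFlowMap Z S)^[k] v j -
      ((powerFlowMap Z S)^[k] w j - 1) / (powerFlowMap Z S)^[k] w j‖ ^ 2 ≤
      K * (t⁻¹ ^ k) ^ 2 *
        (r ^ 2 - ‖((powerFlowMap Z S)^[k] v j - 1) / (powerFlowMap Z S)^[k] v j‖ ^ 2) *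
        (r ^ 2 - ‖((powerFlowMap Z S)^[k] w j - 1) / (powerFlowMap Z S)^[k] w j‖ ^ 2) := by
    intro k
    induction k with
    | zero => simpa using hK'
    | succ k ih =>
      intro i
      simp only [Function.iterate_succ_apply']
      have := h.contraction (h.iterate_mem_region hv k) (h.iterate_mem_region hw k)
        (by positivity) ih i
      rwa [mul_assoc K, ← mul_pow, ← pow_succ] at this
  have hξ : 0 ≤ xi Z S := (nodalXi_nonneg Z S (Classical.arbitrary ι)).trans (nodalXi_le_xi Z S _)
  -- The estimate for iterate k + 1 uses the weights of iterate k, hence the extra factor t; the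
  -- maximum covers k = 0.
  refine ⟨max ‖v - w‖ (√K * (r ^ 2 * xi Z S) * t), fun k => ?_⟩
  rcases k with _ | k
  · simp
  · have hb : ‖(powerFlowMap Z S)^[k + 1] v - (powerFlowMap Z S)^[k + 1] w‖ ≤
        √K * (r ^ 2 * xi Z S) * t⁻¹ ^ k := by
      refine (pi_norm_le_iff_of_nonneg (by positivity)).2 fun i => ?_
      refine le_of_sq_le_sq ?_ (by positivity)
      rw [Pi.sub_apply, Function.iterate_succ_apply', Function.iterate_succ_apply']
      have hv' := h.iterate_mem_region hv k
      have hw' := h.iterate_mem_region hw k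
      have hKk : 0 ≤ K * (t⁻¹ ^ k) ^ 2 := by positivity
      refine (norm_powerFlowMap_sub_sq_le hv' hw' hKk (hk k) i).trans ?_
      calc _ ≤ K * (t⁻¹ ^ k) ^ 2 * (r ^ 2 * xi Z S) * (r ^ 2 * xi Z S) :=
            mul_le_mul (mul_le_mul_of_nonneg_left (sum_weight_le _ i) hKk) (sum_weight_le _ i)
              (sum_weight_nonneg hw' i) (by positivity)
        _ = _ := by
          rw [mul_pow, mul_pow, Real.sq_sqrt hK]
          ring
    refine hb.trans ?_
    calc √K * (r ^ 2 * xi Z S) * t⁻¹ ^ k = √K * (r ^ 2 * xi Z S) * t * t⁻¹ ^ (k + 1) := by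
          rw [pow_succ' t⁻¹ k, mul_assoc _ t, mul_inv_cancel_left₀ ht.ne']
      _ ≤ _ := mul_le_mul_of_nonneg_right (le_max_right _ _) (by positivity)

omit [Nonempty ι] in
lemma inv_lt_one : t⁻¹ < 1 := inv_lt_one_of_one_lt₀ h.2.1

omit [Nonempty ι] in
lemma inv_pos : 0 < t⁻¹ := _root_.inv_pos.2 (one_pos.trans h.2.1)

lemma exists_isSolution : ∃ v ∈ region r, IsSolution Z S v := by
  have hc : (fun i => 1 - nodalEta Z S i) ∈ polydisc Z S r := fun i => by
    simpa using mul_nonneg h.1.le (nodalXi_nonneg Z S i)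
  set c : ι → ℂ := fun i => 1 - nodalEta Z S i
  have hcr := h.polydisc_subset_region hc
  obtain ⟨A, hA⟩ := h.exists_geometric_bound hcr (h.powerFlowMap_mem_region hcr)
  obtain ⟨v, hv⟩ := cauchySeq_tendsto_of_complete (cauchySeq_of_le_geometric t⁻¹ A h.inv_lt_one
    (f := fun k => (powerFlowMap Z S)^[k] c) fun k => by
      rw [dist_eq_norm, Function.iterate_succ_apply]
      exact hA k)
  have hvr : v ∈ region r := by
    -- The region is not closed, but all iterates after the start lie in the closed polydisc inside
    -- it.
    refine h.polydisc_subset_region (isClosed_polydisc.mem_of_tendsto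
      ((tendsto_add_atTop_iff_nat 1).2 hv) (Eventually.of_forall fun k => ?_))
    simp only [Function.iterate_succ_apply']
    exact powerFlowMap_mem_polydisc (fun j => (h.iterate_mem_region hcr k j).1)
      fun j => (h.iterate_mem_region hcr k j).2.le
  refine ⟨v, hvr, fun i => (hvr i).1, ?_⟩
  have hcont : ContinuousAt (powerFlowMap Z S) v := by
    refine continuousAt_pi.2 fun i => continuousAt_const.sub
      (tendsto_finsetSum _ fun j _ => ?_)
    have hne : conj (v j) ≠ 0 := by simpa using (hvr j).1
    exact (continuousAt_const.mul
      ((Complex.continuous_conj.continuousAt.comp (continuousAt_apply j v)).inv₀ hne)).mul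
        continuousAt_const
  refine tendsto_nhds_unique ((tendsto_add_atTop_iff_nat 1).2 hv) ?_
  simp only [Function.iterate_succ_apply']
  exact hcont.tendsto.comp hv

end IsContractionRadius

/-! ### Locating solutions in the full region -/

omit [Nonempty ι] in
lemma IsSolution.iterate_eq {v : ι → ℂ} (hv : IsSolution Z S v) (k : ℕ) :
    (powerFlowMap Z S)^[k] v = v :=
  Function.iterate_fixed hv.2.symm k

lemma exists_radius {v w : ι → ℂ} (hlt : rLower Z S < rUpper Z S)
    (hv : v ∈ region (rUpper Z S)) (hw : w ∈ region (rUpper Z S)) :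
    ∃ r, rLower Z S < r ∧ r < rUpper Z S ∧ v ∈ region r ∧ w ∈ region r := by
  have aux : ∀ {u : ι → ℂ}, u ∈ region (rUpper Z S) →
      ∀ᶠ r in 𝓝[<] (rUpper Z S), u ∈ region r := fun hu =>
    (eventually_all.2 fun i => (lt_mem_nhds (hu i).2).mono fun r hr =>
      ⟨(hu i).1, hr⟩).filter_mono nhdsWithin_le_nhds
  obtain ⟨r, hr⟩ := ((aux hv).and ((aux hw).and (Ioo_mem_nhdsLT hlt))).exists
  exact ⟨r, hr.2.2.1, hr.2.2.2, hr.1, hr.2.1⟩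

/-- For ρ = max |u_j|, a solution lies in D(ρ). If ρ > r̲, then D(ρ) forces |u_j| < ρ for every j,
absurd at the maximizing index. -/
lemma IsSolution.mem_polydisc_rLower (hξ : 0 < xi Z S)
    (h₁ : gamma Z S + 2 * xi Z S * eta Z S < 1) (h₂ : xi Z S - eta Z S ≤ 1) {v : ι → ℂ}
    (hv : IsSolution Z S v) (hvU : v ∈ region (rUpper Z S)) : v ∈ polydisc Z S (rLower Z S) := by
  obtain ⟨i, hi⟩ := Finite.exists_max fun j => ‖(v j - 1) / v j‖
  have hmem := powerFlowMap_mem_polydisc (Z := Z) (S := S) hv.1 hi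
  rw [← hv.2] at hmem
  refine polydisc_mono ?_ hmem
  by_contra! hlt
  obtain ⟨t, ht⟩ := exists_isContractionRadius hξ h₁ h₂ hlt (hvU i).2
  exact lt_irrefl _ (ht.polydisc_subset_region hmem i).2

end Radii

end PowerFlow

theorem theorem1 {ι : Type*} [Fintype ι] [Nonempty ι] (Z : Matrix ι ι ℂ) (S : ι → ℂ)
    (hξ : 0 < PowerFlow.xi Z S)
    (h₁ : PowerFlow.gamma Z S + 2 * PowerFlow.xi Z S * PowerFlow.eta Z S < 1)
    (h₂ : PowerFlow.xi Z S - PowerFlow.eta Z S ≤ 1) :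
    ∃ vhat : ι → ℂ,
      -- `vhat` is the unique solution in the closed polydisc
      (PowerFlow.IsSolution Z S vhat ∧
        vhat ∈ PowerFlow.polydisc Z S (PowerFlow.rLower Z S) ∧
        ∀ w ∈ PowerFlow.polydisc Z S (PowerFlow.rLower Z S),
          PowerFlow.IsSolution Z S w → w = vhat) ∧
      -- no solution elsewhere in the region
      (∀ w ∈ PowerFlow.region (PowerFlow.rUpper Z S) \
          PowerFlow.polydisc Z S (PowerFlow.rLower Z S),
        ¬ PowerFlow.IsSolution Z S w) ∧
      -- from every start in the region the iteration is well defined and converges, at a linear rate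
      (∀ v₀ ∈ PowerFlow.region (PowerFlow.rUpper Z S),
        (∀ k : ℕ, ∀ i, ((PowerFlow.powerFlowMap Z S)^[k] v₀) i ≠ 0) ∧
        Filter.Tendsto (fun k : ℕ => (PowerFlow.powerFlowMap Z S)^[k] v₀) Filter.atTop
          (nhds vhat) ∧
        ∃ μ : ℝ, 0 ≤ μ ∧ μ < 1 ∧
          ∀ k : ℕ, (1 ≤ k ∨ v₀ ∈ PowerFlow.polydisc Z S (PowerFlow.rUpper Z S)) →
            ‖(PowerFlow.powerFlowMap Z S)^[k] v₀ - vhat‖ <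
              PowerFlow.rUpper Z S * PowerFlow.xi Z S * (1 + μ) *
                (2 * μ / (1 + μ ^ 2)) ^ ((k : ℝ) / 2)) := by
  open PowerFlow Filter Topology in
  have hlt := rLower_lt_rUpper hξ h₁
  have hl0 := rLower_nonneg (Z := Z) (S := S)
  obtain ⟨r, hr, hr'⟩ := exists_between hlt
  obtain ⟨t, ht⟩ := exists_isContractionRadius hξ h₁ h₂ hr hr'
  obtain ⟨vhat, hvr, hsol⟩ := ht.exists_isSolution
  have hvU : vhat ∈ region (rUpper Z S) := region_mono hr'.le hvr
  have hvL := hsol.mem_polydisc_rLower hξ h₁ h₂ hvU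
  have hconv : ∀ v ∈ region (rUpper Z S), ∃ A l : ℝ, 0 < l ∧ l < 1 ∧
      ∃ s < rUpper Z S, (∀ k : ℕ, (powerFlowMap Z S)^[k] v ∈ region s) ∧
      ∀ k : ℕ, ‖(powerFlowMap Z S)^[k] v - vhat‖ ≤ A * l ^ k := by
    intro v hv
    obtain ⟨s, hs, hs', hvs, hvhats⟩ := exists_radius hlt hv hvU
    obtain ⟨t, ht⟩ := exists_isContractionRadius hξ h₁ h₂ hs hs'
    obtain ⟨A, hA⟩ := ht.exists_geometric_bound hvs hvhats
    simp only [hsol.iterate_eq] at hA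
    exact ⟨A, t⁻¹, ht.inv_pos, ht.inv_lt_one, s, hs', ht.iterate_mem_region hvs, hA⟩
  have hlim : ∀ v ∈ region (rUpper Z S),
      Tendsto (fun k : ℕ => (powerFlowMap Z S)^[k] v) atTop (𝓝 vhat) := by
    intro v hv
    obtain ⟨A, l, hl, hl1, -, -, -, hA⟩ := hconv v hv
    refine tendsto_iff_norm_sub_tendsto_zero.2 (squeeze_zero (fun _ => norm_nonneg _) hA ?_)
    simpa using (tendsto_pow_atTop_nhds_zero_of_lt_one hl.le hl1).const_mul A
  refine ⟨vhat, ⟨hsol, hvL, fun w hw hws => ?_⟩, fun w hw hws => ?_, fun v hv => ?_⟩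
  · have hwU : w ∈ region (rUpper Z S) :=
      region_mono hr'.le (ht.polydisc_subset_region (polydisc_mono hr.le hw))
    have := hlim w hwU
    simp only [hws.iterate_eq] at this
    exact tendsto_nhds_unique tendsto_const_nhds this
  · exact hw.2 (hws.mem_polydisc_rLower hξ h₁ h₂ hw.1)
  · obtain ⟨A, l, hl, hl1, s, hs, hmem, hA⟩ := hconv v hv
    refine ⟨fun k i => (hmem k i).1, hlim v hv, ?_⟩
    have hu0 : 0 < rUpper Z S := hl0.trans_lt hlt
    -- C bounds the distance from a point of D(r̄) to `vhat` in D(r̲); it is below 2r̄ξ because r̲ <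
    -- r̄.
    obtain ⟨μ, hμ0, hμ1, hμ⟩ := exists_rate (M := rUpper Z S * xi Z S)
      (C := (rUpper Z S + rLower Z S) * xi Z S) (A := A) (by positivity)
      (by nlinarith) hl hl1
    refine ⟨μ, hμ0, hμ1, fun k hk => hμ k _ ?_ (hA k)⟩
    refine norm_sub_le_of_mem_polydisc (by positivity) ?_ hvL
    rcases k with _ | k
    · simpa using hk
    · rw [Function.iterate_succ_apply']
      exact powerFlowMap_mem_polydisc (fun j => (hmem k j).1)
        fun j => ((hmem k j).2.trans hs).le
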